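/- **Notation.** For a finite multiset of non-negative reals, or more generally a weakly decreasing square-summable sequence $\mathbf{d}=(d_1\ge d_2\ge\cdots\ge 0)$ (finite multisets are sorted in weakly decreasing order and padded with $0$'s), write $|\mathbf{d}|_2=(\sum_i d_i^2)^{1/2}$, and let $\mathcal{S}_{\mathbf{d}}$ be the distribution of $\sum_i U_i$, where the $U_i$ are independent and $U_i$ is uniformly distributed on $[-d_i/2,d_i/2]$ (identically $0$ if $d_i=0$). If $|\mathbf d|_2>0$, put $\widehat{\mathbf{d}}=\sqrt{12}\,\mathbf{d}/|\mathbf{d}|_2$. For a distribution $\mathcal{X}$ with mean $\mu$ and standard deviation $\sigma>0$, let $\mathcal{X}^*$ be the distribution of $(X-\mu)/\sigma$, where $X$ has distribution $\mathcal X$. For $\mathbf{t}=(t_1\ge\cdots\ge t_m)$ let $\Delta\mathbf{t}=\{t_i-t_j: 1\le i<j\le m\}$ be its distance multiset. Let $$\mathbf{P}_{\mathrm{DIST}}=\{\widehat{\Delta\mathbf{t}} : m\ge 2,\ 1=t_1\ge\cdots\ge t_m=0\}\subset\mathbb{R}^{\mathbb{N}},$$ $$\mathbf{M}_{\mathrm{DIST}}=\{\mathcal{S}_{\Delta\mathbf{t}}^{*}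 : m\ge 2,\ 1=t_1\ge\cdots\ge t_m=0\},$$ where $\mathbb{R}^{\mathbb{N}}$ carries the topology of pointwise convergence, and $\mathbf{M}_{\mathrm{DIST}}$ is viewed inside the space of probability distributions on $\mathbb{R}$ with the topology of convergence in distribution (the topology of the Lévy metric). Let $\mathbf{0}$ be the zero sequence and $\mathcal{N}(0,1)$ the standard normal distribution. **Theorem.** 1. $\overline{\mathbf{P}_{\mathrm{DIST}}}=\mathbf{P}_{\mathrm{DIST}}\sqcup\{\mathbf{0}\}$ (disjoint union). 2. $\overline{\mathbf{M}_{\mathrm{DIST}}}=\mathbf{M}_{\mathrm{DIST}}\sqcup\{\mathcal{N}(0,1)\}$ (disjoint union). 3. The map $\overline{\mathbf{P}_{\mathrm{DIST}}}\to\overline{\mathbf{M}_{\mathrm{DIST}}}$ given by $\mathbf{d}\mapsto\mathcal{S}_{\mathbf{d}}$ for $\mathbf{d}\in\mathbf{P}_{\mathrm{DIST}}$ and $\mathbf{0}\mapsto\mathcal{N}(0,1)$ is well defined and a homeomorphism. 4. Both $\overline{\mathbf{P}_{\mathrm{DIST}}}$ and $\overline{\mathbf{M}_{\mathrm{DIST}}}$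 are compact and sequentially compact. -/

import Mathlib

open MeasureTheory ProbabilityTheory Filter Topology

namespace DistModuli

noncomputable section

/-- The continuous uniform distribution `U[a, b]` on the real line; for `a = b` it is the
point mass at `a`. -/
def uniformLaw (a b : ℝ) : Measure ℝ :=
  if a < b then cond volume (Set.Icc a b) else Measure.dirac a

instance isProbabilityMeasure_uniformLaw (a b : ℝ) : IsProbabilityMeasure (uniformLaw a b) := by
  unfold uniformLaw
  split_ifs with h
  · exact cond_isProbabilityMeasure_of_finite
      (by simp [Real.volume_Icc, h]) (by simp [Real.volume_Icc])
  · infer_instance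

/-- The joint law of independent coordinates `U_k ~ U[-t_k/2, t_k/2]`, `k = 0, 1, 2, …`. -/
def uniformSeqLaw (t : ℕ → ℝ) : Measure (ℕ → ℝ) :=
  Measure.infinitePi fun k => uniformLaw (-(t k) / 2) (t k / 2)

instance isProbabilityMeasure_uniformSeqLaw (t : ℕ → ℝ) :
    IsProbabilityMeasure (uniformSeqLaw t) := by
  unfold uniformSeqLaw
  infer_instance

/-- The sum of a sequence of reals, as the limit of its partial sums. -/
def seriesLimit (u : ℕ → ℝ) : ℝ :=
  limUnder atTop fun n => ∑ k ∈ Finset.range n, u k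

theorem measurable_seriesLimit : Measurable seriesLimit := by
  refine (StronglyMeasurable.limUnder (l := atTop)
    (f := fun n (u : ℕ → ℝ) => ∑ k ∈ Finset.range n, u k) fun n => ?_).measurable
  exact (Finset.measurable_sum _ fun k _ => measurable_pi_apply k).stronglyMeasurable

/-- The uniform sum distribution `S_t`, i.e. the law of `∑_k U_k` for independent
`U_k ~ U[-t_k/2, t_k/2]` (the sum converges almost surely when `t` is square summable,
and is a finite sum when `t` has finite support). -/
def uniformSum (t : ℕ → ℝ) : ProbabilityMeasure ℝ :=
  ⟨(uniformSeqLaw t).map seriesLimit,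
    Measure.isProbabilityMeasure_map measurable_seriesLimit.aemeasurable⟩

/-- The standard normal distribution `N(0, 1)`. -/
def stdNormal : ProbabilityMeasure ℝ :=
  ⟨gaussianReal 0 1, inferInstance⟩

/-- The standardization `X* = (X - μ) / σ`, at the level of laws. -/
def standardize (P : ProbabilityMeasure ℝ) : ProbabilityMeasure ℝ :=
  P.map (f := fun x : ℝ =>
      (x - ∫ y, y ∂(P : Measure ℝ)) / Real.sqrt (variance id (P : Measure ℝ)))
    (by fun_prop)

/-- A finite multiset of reals, sorted in weakly decreasing order and padded with zeros. -/
def padSeq (s : Multiset ℝ) : ℕ → ℝ :=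
  fun k => (s.sort (· ≥ ·)).getD k 0

/-- The distance multiset `Δt = {t_i - t_j : i < j}`. -/
def distMultiset {m : ℕ} (t : Fin m → ℝ) : Multiset ℝ :=
  (Finset.univ.filter fun p : Fin m × Fin m => p.1 < p.2).val.map fun p => t p.1 - t p.2

/-- The distance multiset regarded as a decreasing sequence padded with zeros. -/
def distSeq {m : ℕ} (t : Fin m → ℝ) : ℕ → ℝ :=
  padSeq (distMultiset t)

/-- The rescaling `√12 · t / |t|₂` of a square-summable sequence of positive `2`-norm. -/
def hat (t : ℕ → ℝ) : ℕ → ℝ :=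
  fun k => Real.sqrt 12 * t k / Real.sqrt (∑' j, t j ^ 2)

/-- The sequences `1 = t_1 ≥ ⋯ ≥ t_m = 0`, of length `m = n + 2 ≥ 2`. -/
def IsNormalized {n : ℕ} (t : Fin (n + 2) → ℝ) : Prop :=
  t 0 = 1 ∧ Antitone t ∧ t (Fin.last (n + 1)) = 0

/-- The parameter space of distance multisets, inside `ℝ^ℕ` with the topology of pointwise
convergence. -/
def PDist : Set (ℕ → ℝ) :=
  {d | ∃ (n : ℕ) (t : Fin (n + 2) → ℝ), IsNormalized t ∧ d = hat (distSeq t)}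

/-- The moduli space of distance distributions, inside the space of probability measures on `ℝ`
with the topology of convergence in distribution. -/
def MDist : Set (ProbabilityMeasure ℝ) :=
  {P | ∃ (n : ℕ) (t : Fin (n + 2) → ℝ), IsNormalized t ∧
    P = standardize (uniformSum (distSeq t))}

end

end DistModuli

namespace DistModuli

/-! ### The law of a finite uniform sum -/

/-! The characteristic function of `uniformSum d` is `∏ sinc (d k * ξ / 2)` and its variance is
`|d|₂² / 12`, so standardizing a law amounts to applying `hat` to its scales
(`standardize_uniformSum`).

The decisive estimate is `le_gapEnergy`: `m` points spanning `[0, 1]` have squared gaps summing to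
at least `m / 4`, while no gap exceeds 1. Hence the largest rescaled gap is at most `√(48 / m)`. Any
region `d 0 > c > 0` thus meets only finitely many of the compact pieces `PDistOf n`, and only `0`
can be added by closure.

The map to laws is continuous. Near a nonzero point the product has a fixed finite number of
factors; at `0` it differs from the Gaussian by at most `3 |ξ|³ d 0`. It is injective because the
first positive zero of the product is `2π / d 0`: the largest scale can be read off, its factor
cancelled, and the argument repeated. A continuous bijection from a compact space to a Hausdorff one
is a homeomorphism. -/

lemma integral_uniformLaw {E : Type*} [NormedAddCommGroup E] [NormedSpace ℝ E]
    {a : ℝ} (ha : 0 < a) (f : ℝ → E) :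
    ∫ x, f x ∂(uniformLaw (-a / 2) (a / 2)) = a⁻¹ • ∫ x in (-a / 2)..(a / 2), f x := by
  have h : -a / 2 < a / 2 := by linarith
  rw [uniformLaw, if_pos h, ProbabilityTheory.cond, integral_smul_measure,
    integral_Icc_eq_integral_Ioc, intervalIntegral.integral_of_le h.le, Real.volume_Icc,
    ENNReal.toReal_inv, ENNReal.toReal_ofReal (by linarith)]
  congr 2
  ring

lemma uniformLaw_zero : uniformLaw (-(0 : ℝ) / 2) (0 / 2) = Measure.dirac 0 := by
  simp [uniformLaw]

lemma charFun_uniformLaw {a : ℝ} (ha : 0 ≤ a) (ξ : ℝ) :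
    charFun (uniformLaw (-a / 2) (a / 2)) ξ = (Real.sinc (a * ξ / 2) : ℂ) := by
  rcases ha.eq_or_lt with rfl | ha
  · rw [uniformLaw_zero, charFun_dirac]
    simp
  rw [charFun_apply_real, integral_uniformLaw ha]
  rcases eq_or_ne ξ 0 with rfl | hξ
  · have ha' : (a : ℂ) ≠ 0 := by exact_mod_cast ha.ne'
    simp
    field_simp
    ring
  have h := intervalIntegral.integral_comp_mul_left (a := -a / 2) (b := a / 2)
    (fun y : ℝ => Complex.exp (y * Complex.I)) hξ
  have e : ξ * (-a / 2) = -(a * ξ / 2) := by ring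
  have e' : ξ * (a / 2) = a * ξ / 2 := by ring
  simp only [Complex.ofReal_mul] at h
  rw [h, e, e', integral_exp_mul_I_eq_sinc]
  have ha' : (a : ℂ) ≠ 0 := by exact_mod_cast ha.ne'
  have hξ' : (ξ : ℂ) ≠ 0 := by exact_mod_cast hξ
  simp only [Complex.real_smul]
  push_cast
  field_simp

lemma integral_id_uniformLaw {a : ℝ} (ha : 0 ≤ a) :
    ∫ x, x ∂(uniformLaw (-a / 2) (a / 2)) = 0 := by
  rcases ha.eq_or_lt with rfl | ha
  · rw [uniformLaw_zero, integral_dirac]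
  · rw [integral_uniformLaw ha, integral_id, smul_eq_mul]
    ring

lemma memLp_id_uniformLaw {a : ℝ} (ha : 0 ≤ a) (p : ENNReal) :
    MemLp id p (uniformLaw (-a / 2) (a / 2)) := by
  refine memLp_of_bounded (a := -a / 2) (b := a / 2) ?_ aestronglyMeasurable_id p
  rcases ha.eq_or_lt with rfl | ha
  · rw [uniformLaw_zero]
    simp [ae_dirac_eq]
  · rw [uniformLaw, if_pos (by linarith)]
    exact ae_cond_mem measurableSet_Icc

lemma variance_id_uniformLaw {a : ℝ} (ha : 0 ≤ a) :
    variance id (uniformLaw (-a / 2) (a / 2)) = a ^ 2 / 12 := by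
  rw [variance_of_integral_eq_zero aemeasurable_id (integral_id_uniformLaw ha)]
  rcases ha.eq_or_lt with rfl | ha
  · rw [uniformLaw_zero, integral_dirac]
    simp
  · rw [integral_uniformLaw ha]
    simp only [id, integral_pow, smul_eq_mul]
    field_simp
    norm_num
    ring

section

variable {d : ℕ → ℝ} {N : ℕ}

lemma map_eval_uniformSeqLaw (d : ℕ → ℝ) (k : ℕ) :
    (uniformSeqLaw d).map (fun u => u k) = uniformLaw (-(d k) / 2) (d k / 2) :=
  Measure.infinitePi_map_eval _ k

lemma iIndepFun_uniformSeqLaw (d : ℕ → ℝ) :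
    iIndepFun (fun (k : ℕ) (u : ℕ → ℝ) => u k) (uniformSeqLaw d) :=
  iIndepFun_infinitePi (X := fun _ x => x) fun _ => measurable_id

/-- Coordinates beyond `N` have law `dirac 0`, so the partial sums are almost surely eventually
constant and the limit is genuine. -/
lemma ae_seriesLimit_eq (hN : ∀ k, N ≤ k → d k = 0) :
    ∀ᵐ u ∂(uniformSeqLaw d), seriesLimit u = ∑ k ∈ Finset.range N, u k := by
  have h : ∀ᵐ u ∂(uniformSeqLaw d), ∀ k, N ≤ k → u k = 0 := by
    refine ae_all_iff.2 fun k => ?_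
    by_cases hk : N ≤ k
    · have h0 : ∀ᵐ x ∂((uniformSeqLaw d).map fun u => u k), x = 0 := by
        rw [map_eval_uniformSeqLaw, hN k hk, uniformLaw_zero, ae_dirac_eq]
        simp
      filter_upwards [ae_of_ae_map (measurable_pi_apply k).aemeasurable h0] with u hu _ using hu
    · exact Eventually.of_forall fun u hk' => absurd hk' hk
  filter_upwards [h] with u hu
  refine Tendsto.limUnder_eq (tendsto_atTop_of_eventually_const (i₀ := N) fun n hn => ?_)
  refine (Finset.sum_subset (Finset.range_mono hn) fun k _ hk => hu k ?_).symm
  simpa using hk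

lemma uniformSum_eq_map (hN : ∀ k, N ≤ k → d k = 0) :
    (uniformSum d : Measure ℝ) =
      (uniformSeqLaw d).map fun u => ∑ k ∈ Finset.range N, u k :=
  Measure.map_congr (ae_seriesLimit_eq hN)

lemma charFun_uniformSum (h0 : ∀ k, 0 ≤ d k) (hN : ∀ k, N ≤ k → d k = 0) (ξ : ℝ) :
    charFun (uniformSum d : Measure ℝ) ξ =
      ((∏ k ∈ Finset.range N, Real.sinc (d k * ξ / 2) : ℝ) : ℂ) := by
  rw [uniformSum_eq_map hN, iIndepFun.charFun_map_fun_finsetSum_eq_prod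
    (X := fun (k : ℕ) (u : ℕ → ℝ) => u k) (fun k _ => (measurable_pi_apply k).aemeasurable)
    ((iIndepFun_uniformSeqLaw d).restrict _), Finset.prod_apply]
  push_cast
  refine Finset.prod_congr rfl fun k _ => ?_
  rw [map_eval_uniformSeqLaw, charFun_uniformLaw (h0 k)]

lemma memLp_eval_uniformSeqLaw (h0 : ∀ k, 0 ≤ d k) (p : ENNReal) (k : ℕ) :
    MemLp (fun u : ℕ → ℝ => u k) p (uniformSeqLaw d) := by
  have h := memLp_id_uniformLaw (h0 k) p
  rw [← map_eval_uniformSeqLaw] at h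
  exact (memLp_map_measure_iff aestronglyMeasurable_id (measurable_pi_apply k).aemeasurable).1 h

lemma integral_id_uniformSum (h0 : ∀ k, 0 ≤ d k) (hN : ∀ k, N ≤ k → d k = 0) :
    ∫ x, x ∂(uniformSum d : Measure ℝ) = 0 := by
  rw [uniformSum_eq_map hN, integral_map (by fun_prop) (by fun_prop), integral_finsetSum]
  · refine Finset.sum_eq_zero fun k _ => ?_
    have h := integral_id_uniformLaw (h0 k)
    rwa [← map_eval_uniformSeqLaw, integral_map (measurable_pi_apply k).aemeasurable
      (by fun_prop)] at h
  · exact fun k _ => (memLp_eval_uniformSeqLaw h0 1 k).integrable le_rfl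

lemma variance_id_uniformSum (h0 : ∀ k, 0 ≤ d k) (hN : ∀ k, N ≤ k → d k = 0) :
    variance id (uniformSum d : Measure ℝ) = (∑ k ∈ Finset.range N, d k ^ 2) / 12 := by
  rw [uniformSum_eq_map hN, variance_id_map (by fun_prop)]
  have h := IndepFun.variance_sum (μ := uniformSeqLaw d) (s := Finset.range N)
    (X := fun (k : ℕ) (u : ℕ → ℝ) => u k) (fun k _ => memLp_eval_uniformSeqLaw h0 2 k)
    (fun i _ j _ hij => (iIndepFun_uniformSeqLaw d).indepFun hij)
  have e : (∑ k ∈ Finset.range N, fun u : ℕ → ℝ => u k) =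
      fun u : ℕ → ℝ => ∑ k ∈ Finset.range N, u k := by
    ext u
    simp
  rw [e] at h
  rw [h, Finset.sum_div]
  refine Finset.sum_congr rfl fun k _ => ?_
  rw [← variance_id_uniformLaw (h0 k), ← map_eval_uniformSeqLaw,
    variance_id_map (measurable_pi_apply k).aemeasurable]

lemma hat_eq (hN : ∀ k, N ≤ k → d k = 0) (k : ℕ) :
    hat d k = Real.sqrt 12 * d k / Real.sqrt (∑ j ∈ Finset.range N, d j ^ 2) := by
  rw [hat, tsum_eq_sum (s := Finset.range N)]
  intro j hj
  rw [hN j (by simpa using hj)]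
  simp

/-- Dividing by `σ = |d|₂ / √12` rescales each argument of `sinc`. For `d = 0` both sides are the
point mass at 0, since division by zero gives 0. -/
lemma standardize_uniformSum (h0 : ∀ k, 0 ≤ d k) (hN : ∀ k, N ≤ k → d k = 0) :
    standardize (uniformSum d) = uniformSum (hat d) := by
  have h0' : ∀ k, 0 ≤ hat d k := fun k => by
    have := h0 k
    rw [hat]
    positivity
  have hN' : ∀ k, N ≤ k → hat d k = 0 := fun k hk => by simp [hat, hN k hk]
  suffices h : ((standardize (uniformSum d) : ProbabilityMeasure ℝ) : Measure ℝ) =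
      (uniformSum (hat d) : ProbabilityMeasure ℝ) from Subtype.ext h
  refine Measure.ext_of_charFun (funext fun ξ => ?_)
  rw [charFun_uniformSum h0' hN']
  rw [standardize, ProbabilityMeasure.toMeasure_map, integral_id_uniformSum h0 hN,
    variance_id_uniformSum h0 hN]
  have e : (fun x : ℝ => (x - 0) / Real.sqrt ((∑ k ∈ Finset.range N, d k ^ 2) / 12)) =
      fun x => (Real.sqrt ((∑ k ∈ Finset.range N, d k ^ 2) / 12))⁻¹ * x := by
    ext x
    rw [sub_zero, div_eq_inv_mul]
  rw [e, charFun_map_mul, charFun_uniformSum h0 hN]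
  congr 1
  refine Finset.prod_congr rfl fun k _ => ?_
  rw [hat_eq hN, Real.sqrt_div' _ (by norm_num), inv_div]
  congr 1
  ring

end

/-! ### Distance sequences and compactness for a bounded number of points -/

/-- The index pairs `i < j` of a distance multiset. -/
abbrev Pairs (m : ℕ) : Type := {p : Fin m × Fin m // p.1 < p.2}

/-- The gaps of `t`, listed along an enumeration of the pairs and padded with zeros. -/
def gapSeq {m N : ℕ} (e : Fin N ≃ Pairs m) (t : Fin m → ℝ) (k : ℕ) : ℝ :=
  if h : k < N then t (e ⟨k, h⟩).1.1 - t (e ⟨k, h⟩).1.2 else 0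

/-- The sum of the squared gaps of `t`. -/
def gapEnergy {m : ℕ} (t : Fin m → ℝ) : ℝ :=
  ∑ p : Pairs m, (t p.1.1 - t p.1.2) ^ 2

lemma padSeq_ofFn {N : ℕ} {f : Fin N → ℝ} (hf : Antitone f) (k : ℕ) :
    padSeq (List.ofFn f : Multiset ℝ) k = if h : k < N then f ⟨k, h⟩ else 0 := by
  have hs : (List.ofFn f).Pairwise (· ≥ ·) :=
    List.pairwise_ofFn.2 fun i j hij => hf hij.le
  have : (List.ofFn f : Multiset ℝ).sort (· ≥ ·) = List.ofFn f := by
    rw [Multiset.coe_sort]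
    exact List.mergeSort_eq_self _ hs
  rw [padSeq, this]
  split_ifs with h <;> simp [List.getD, h]

lemma distMultiset_eq {m N : ℕ} (e : Fin N ≃ Pairs m) (t : Fin m → ℝ) :
    distMultiset t = (List.ofFn fun k => t (e k).1.1 - t (e k).1.2 : Multiset ℝ) := by
  have h : (Finset.univ.filter fun p : Fin m × Fin m => p.1 < p.2) =
      Finset.univ.map (e.toEmbedding.trans (Function.Embedding.subtype _)) := by
    ext p
    simp only [Finset.mem_filter, Finset.mem_univ, true_and, Finset.mem_map,
      Function.Embedding.trans_apply, Equiv.coe_toEmbedding, Function.Embedding.subtype_apply]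
    exact ⟨fun hp => ⟨e.symm ⟨p, hp⟩, by simp⟩, fun ⟨k, hk⟩ => hk ▸ (e k).2⟩
  rw [distMultiset, h, Finset.map_val, Multiset.map_map, ← Fin.univ_val_map]
  rfl

/-- The sorting permutation varies with `t`; once an enumeration is fixed, every term is linear in
`t`. -/
lemma distSeq_eq_gapSeq {m N : ℕ} {e : Fin N ≃ Pairs m} {t : Fin m → ℝ}
    (h : Antitone fun k => t (e k).1.1 - t (e k).1.2) : distSeq t = gapSeq e t := by
  ext k
  rw [distSeq, distMultiset_eq e, padSeq_ofFn h, gapSeq]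

lemma exists_antitone_enumeration {m : ℕ} (t : Fin m → ℝ) :
    ∃ e : Fin (Fintype.card (Pairs m)) ≃ Pairs m,
      Antitone fun k => t (e k).1.1 - t (e k).1.2 := by
  let e₀ := (Fintype.equivFin (Pairs m)).symm
  -- `Tuple.sort` sorts increasingly, hence the sign.
  let f : Fin (Fintype.card (Pairs m)) → ℝ := fun k => -(t (e₀ k).1.1 - t (e₀ k).1.2)
  refine ⟨(Tuple.sort f).trans e₀, fun i j hij => ?_⟩
  exact neg_le_neg_iff.1 (Tuple.monotone_sort f hij)

lemma sum_gapSeq_sq {m N : ℕ} (e : Fin N ≃ Pairs m) (t : Fin m → ℝ) :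
    ∑ k ∈ Finset.range N, gapSeq e t k ^ 2 = gapEnergy t := by
  rw [Finset.sum_range, gapEnergy, ← e.sum_comp]
  refine Finset.sum_congr rfl fun k _ => ?_
  simp [gapSeq]

lemma two_mul_gapEnergy {m : ℕ} (t : Fin m → ℝ) :
    2 * gapEnergy t = ∑ j, ∑ i, (t i - t j) ^ 2 := by
  have h1 : gapEnergy t = ∑ p : Fin m × Fin m with p.1 < p.2, (t p.1 - t p.2) ^ 2 := by
    exact (Finset.sum_subtype _ (by simp) fun p : Fin m × Fin m => (t p.1 - t p.2) ^ 2).symm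
  have h2 : ∑ p : Fin m × Fin m with ¬ p.1 < p.2, (t p.1 - t p.2) ^ 2 =
      ∑ p : Fin m × Fin m with p.1 < p.2, (t p.1 - t p.2) ^ 2 := by
    rw [Finset.sum_filter, Finset.sum_filter,
      ← (Equiv.prodComm (Fin m) (Fin m)).sum_comp]
    refine Finset.sum_congr rfl fun p _ => ?_
    rcases lt_trichotomy p.1 p.2 with h | h | h
    · simp [h, h.not_gt, sub_sq_comm]
    · simp [h]
    · simp [h, h.not_gt]
  rw [← Finset.sum_product', two_mul, h1]
  nth_rw 2 [← h2]
  rw [Finset.sum_filter_add_sum_filter_not]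
  exact Fintype.sum_equiv (Equiv.prodComm _ _) _ _ fun p => by simp

/-- The distances from `t j` to the two endpoints alone contribute `(1 - t j)² + (t j)² ≥ 1/2`;
summing over `j` counts every pair twice. -/
lemma le_gapEnergy {n : ℕ} {t : Fin (n + 2) → ℝ} (ht : IsNormalized t) :
    ((n : ℝ) + 2) / 4 ≤ gapEnergy t := by
  have h : ∀ j, (1 : ℝ) / 2 ≤ ∑ i, (t i - t j) ^ 2 := fun j => by
    have h01 : (0 : Fin (n + 2)) ≠ Fin.last (n + 1) := by simp [Fin.ext_iff]
    have := Finset.sum_le_univ_sum_of_nonneg (s := {0, Fin.last (n + 1)})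
      (f := fun i => (t i - t j) ^ 2) (fun i => sq_nonneg _)
    rw [Finset.sum_pair h01, ht.1, ht.2.2] at this
    nlinarith [sq_nonneg (2 * t j - 1)]
  have h2 := Finset.sum_le_sum (s := Finset.univ) fun j _ => h j
  rw [← two_mul_gapEnergy] at h2
  simp at h2
  linarith

/-- Decreasing nonnegative sequences supported in `[0, N)` whose squared `2`-norm is `12`. -/
structure IsSpectrum (N : ℕ) (d : ℕ → ℝ) : Prop where
  antitone : Antitone d
  nonneg : ∀ k, 0 ≤ d k
  eq_zero : ∀ k, N ≤ k → d k = 0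
  sum_sq : ∑ k ∈ Finset.range N, d k ^ 2 = 12

lemma IsSpectrum.zero_pos {N : ℕ} {d : ℕ → ℝ} (h : IsSpectrum N d) : 0 < d 0 := by
  refine (h.nonneg 0).lt_of_ne fun h0 => ?_
  have hd : ∀ k, d k = 0 := fun k =>
    le_antisymm ((h.antitone k.zero_le).trans h0.ge) (h.nonneg k)
  simpa [hd] using h.sum_sq

/-- The part of the parameter space coming from `n + 2` points. -/
def PDistOf (n : ℕ) : Set (ℕ → ℝ) :=
  {d | ∃ t : Fin (n + 2) → ℝ, IsNormalized t ∧ d = hat (distSeq t)}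

lemma PDist_eq_iUnion : PDist = ⋃ n, PDistOf n := by
  ext d
  simp [PDist, PDistOf]

section

variable {n : ℕ} {t : Fin (n + 2) → ℝ}

lemma gapEnergy_pos (ht : IsNormalized t) : 0 < gapEnergy t :=
  lt_of_lt_of_le (by positivity) (le_gapEnergy ht)

lemma IsNormalized.distSeq_nonneg (ht : IsNormalized t) (k : ℕ) : 0 ≤ distSeq t k := by
  obtain ⟨e, he⟩ := exists_antitone_enumeration t
  rw [distSeq_eq_gapSeq he, gapSeq]
  split_ifs with h
  · exact sub_nonneg.2 (ht.2.1 (e ⟨k, h⟩).2.le)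
  · exact le_rfl

lemma distSeq_eq_zero {m : ℕ} (t : Fin m → ℝ) (k : ℕ) (hk : Fintype.card (Pairs m) ≤ k) :
    distSeq t k = 0 := by
  obtain ⟨e, he⟩ := exists_antitone_enumeration t
  rw [distSeq_eq_gapSeq he, gapSeq, dif_neg hk.not_gt]

lemma sum_distSeq_sq {m : ℕ} (t : Fin m → ℝ) :
    ∑ k ∈ Finset.range (Fintype.card (Pairs m)), distSeq t k ^ 2 = gapEnergy t := by
  obtain ⟨e, he⟩ := exists_antitone_enumeration t
  rw [distSeq_eq_gapSeq he, sum_gapSeq_sq]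

lemma IsNormalized.antitone_distSeq (ht : IsNormalized t) : Antitone (distSeq t) := by
  obtain ⟨e, he⟩ := exists_antitone_enumeration t
  intro i j hij
  by_cases hj : j < Fintype.card (Pairs (n + 2))
  · rw [distSeq_eq_gapSeq he, gapSeq, gapSeq, dif_pos hj, dif_pos (hij.trans_lt hj)]
    exact he (by simpa using hij)
  · rw [distSeq_eq_zero t j (not_lt.1 hj)]
    exact ht.distSeq_nonneg i

lemma IsNormalized.distSeq_zero_le (ht : IsNormalized t) : distSeq t 0 ≤ 1 := by
  obtain ⟨e, he⟩ := exists_antitone_enumeration t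
  rw [distSeq_eq_gapSeq he, gapSeq]
  split_ifs with h
  · have h1 := ht.2.1 (Fin.zero_le (e ⟨0, h⟩).1.1)
    have h2 := ht.2.1 (Fin.le_last (e ⟨0, h⟩).1.2)
    rw [ht.1] at h1
    rw [ht.2.2] at h2
    linarith
  · exact zero_le_one

lemma hat_distSeq {m : ℕ} (t : Fin m → ℝ) (k : ℕ) :
    hat (distSeq t) k = Real.sqrt 12 * distSeq t k / Real.sqrt (gapEnergy t) := by
  rw [hat_eq (distSeq_eq_zero t), sum_distSeq_sq]

lemma IsNormalized.isSpectrum (ht : IsNormalized t) :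
    IsSpectrum (Fintype.card (Pairs (n + 2))) (hat (distSeq t)) where
  antitone i j hij := by
    have := ht.antitone_distSeq hij
    rw [hat_distSeq, hat_distSeq]
    gcongr
  nonneg k := by
    have := ht.distSeq_nonneg k
    rw [hat_distSeq]
    positivity
  eq_zero k hk := by simp [hat_distSeq, distSeq_eq_zero t k hk]
  sum_sq := by
    have h := gapEnergy_pos ht
    simp_rw [hat_distSeq, div_pow, mul_pow]
    rw [← Finset.sum_div, ← Finset.mul_sum, sum_distSeq_sq, Real.sq_sqrt (by norm_num),
      Real.sq_sqrt h.le]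
    field_simp

lemma IsNormalized.hat_sq_le (ht : IsNormalized t) :
    ((n : ℝ) + 2) * hat (distSeq t) 0 ^ 2 ≤ 48 := by
  have h := gapEnergy_pos ht
  have h1 : distSeq t 0 ^ 2 ≤ 1 := pow_le_one₀ (ht.distSeq_nonneg 0) ht.distSeq_zero_le
  rw [hat_distSeq, div_pow, mul_pow, Real.sq_sqrt (by norm_num), Real.sq_sqrt h.le,
    mul_div_assoc', div_le_iff₀ h]
  nlinarith [le_gapEnergy ht, mul_le_mul_of_nonneg_left h1 (by positivity : (0:ℝ) ≤ (n : ℝ) + 2)]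

end

lemma PDistOf.isSpectrum {n : ℕ} {d : ℕ → ℝ} (h : d ∈ PDistOf n) :
    IsSpectrum (Fintype.card (Pairs (n + 2))) d := by
  obtain ⟨t, ht, rfl⟩ := h
  exact ht.isSpectrum

lemma PDistOf.sq_le {n : ℕ} {d : ℕ → ℝ} (h : d ∈ PDistOf n) : ((n : ℝ) + 2) * d 0 ^ 2 ≤ 48 := by
  obtain ⟨t, ht, rfl⟩ := h
  exact ht.hat_sq_le

lemma exists_isNormalized (n : ℕ) : ∃ t : Fin (n + 2) → ℝ, IsNormalized t := by
  refine ⟨fun i => if i = 0 then 1 else 0, by simp, fun i j hij => ?_, by simp⟩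
  by_cases hi : i = 0
  · dsimp only
    split_ifs <;> norm_num
  · have hj : j ≠ 0 := fun h => hi (le_antisymm (h ▸ hij) (Fin.zero_le _))
    simp [hi, hj]

lemma PDistOf_nonempty (n : ℕ) : (PDistOf n).Nonempty :=
  let ⟨t, ht⟩ := exists_isNormalized n
  ⟨_, t, ht, rfl⟩

lemma isCompact_setOf_isNormalized (n : ℕ) :
    IsCompact {t : Fin (n + 2) → ℝ | IsNormalized t} := by
  refine (isCompact_univ_pi fun _ : Fin (n + 2) => isCompact_Icc (a := (0 : ℝ)) (b := 1)).of_isClosed_subset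
    ?_ ?_
  · refine (isClosed_eq (by fun_prop) (by fun_prop)).inter
      (IsClosed.inter ?_ (isClosed_eq (by fun_prop) (by fun_prop)))
    exact isClosed_antitone
  · intro t ht i _
    exact ⟨ht.2.2 ▸ ht.2.1 (Fin.le_last i), ht.1 ▸ ht.2.1 (Fin.zero_le i)⟩

/-- The normalized `t` split into finitely many compact sets, one for each enumeration that sorts
the gaps, and on each of them the parameter depends continuously on `t`. -/
lemma isCompact_PDistOf (n : ℕ) : IsCompact (PDistOf n) := by
  let A (e : Fin (Fintype.card (Pairs (n + 2))) ≃ Pairs (n + 2)) : Set (Fin (n + 2) → ℝ) :=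
    {t | IsNormalized t} ∩ {t | Antitone fun k => t (e k).1.1 - t (e k).1.2}
  let F (e : Fin (Fintype.card (Pairs (n + 2))) ≃ Pairs (n + 2)) (t : Fin (n + 2) → ℝ)
    (k : ℕ) : ℝ := Real.sqrt 12 * gapSeq e t k / Real.sqrt (gapEnergy t)
  have hF : ∀ e, ∀ t ∈ A e, hat (distSeq t) = F e t := fun e t ht => by
    ext k
    rw [hat_distSeq, distSeq_eq_gapSeq ht.2]
  have hU : PDistOf n = ⋃ e, F e '' A e := by
    ext d
    simp only [PDistOf, Set.mem_ofPred_eq, Set.mem_iUnion, Set.mem_image]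
    constructor
    · rintro ⟨t, ht, rfl⟩
      obtain ⟨e, he⟩ := exists_antitone_enumeration t
      exact ⟨e, t, ⟨ht, he⟩, (hF e t ⟨ht, he⟩).symm⟩
    · rintro ⟨e, t, ht, rfl⟩
      exact ⟨t, ht.1, (hF e t ht).symm⟩
  rw [hU]
  refine isCompact_iUnion fun e => IsCompact.image_of_continuousOn ?_ ?_
  · refine (isCompact_setOf_isNormalized n).inter_right ?_
    exact isClosed_antitone.preimage (f := fun (t : Fin (n + 2) → ℝ) k =>
      t (e k).1.1 - t (e k).1.2) (by fun_prop)
  · refine continuousOn_pi.2 fun k => ContinuousOn.div ?_ ?_ fun t ht =>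
      (Real.sqrt_pos.2 (gapEnergy_pos ht.1)).ne'
    · refine Continuous.continuousOn (continuous_const.mul ?_)
      unfold gapSeq
      split_ifs <;> fun_prop
    · unfold gapEnergy
      fun_prop

/-! ### The closure of the parameter space -/

lemma zero_notMem_PDist : (0 : ℕ → ℝ) ∉ PDist := by
  rw [PDist_eq_iUnion, Set.mem_iUnion]
  rintro ⟨n, hn⟩
  simpa using (PDistOf.isSpectrum hn).zero_pos

/-- Any choice of one point in each `PDistOf n` converges to 0, by the bound `√(48 / (n + 2))` on
the largest term. -/
lemma zero_mem_closure_PDist : (0 : ℕ → ℝ) ∈ closure PDist := by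
  choose d hd using PDistOf_nonempty
  refine mem_closure_of_tendsto (f := d) (b := atTop) (tendsto_pi_nhds.2 fun k => ?_)
    (Eventually.of_forall fun n => PDist_eq_iUnion ▸ Set.mem_iUnion.2 ⟨n, hd n⟩)
  have hlim : Tendsto (fun n : ℕ => Real.sqrt (48 / ((n : ℝ) + 2))) atTop (𝓝 0) := by
    rw [← Real.sqrt_zero]
    refine (Real.continuous_sqrt.tendsto 0).comp (tendsto_const_nhds.div_atTop ?_)
    exact tendsto_atTop_add_const_right _ _ tendsto_natCast_atTop_atTop
  refine squeeze_zero (fun n => (PDistOf.isSpectrum (hd n)).nonneg k) (fun n => ?_) hlim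
  refine ((PDistOf.isSpectrum (hd n)).antitone k.zero_le).trans (Real.le_sqrt_of_sq_le ?_)
  rw [le_div_iff₀ (by positivity), mul_comm]
  exact PDistOf.sq_le (hd n)

lemma exists_subset_biUnion_PDistOf {c : ℝ} (hc : 0 < c) :
    ∃ M : ℕ, PDist ∩ {d | c < d 0} ⊆ ⋃ n ∈ Finset.range M, PDistOf n := by
  obtain ⟨M, hM⟩ := exists_nat_gt (48 / c ^ 2)
  refine ⟨M, fun d ⟨hd, hdc⟩ => ?_⟩
  rw [PDist_eq_iUnion, Set.mem_iUnion] at hd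
  obtain ⟨n, hn⟩ := hd
  refine Set.mem_biUnion (Finset.mem_coe.2 (Finset.mem_range.2 ?_)) hn
  have h1 := PDistOf.sq_le hn
  have h2 : c ^ 2 ≤ d 0 ^ 2 := pow_le_pow_left₀ hc.le (le_of_lt hdc) 2
  have h3 : (n : ℝ) + 2 ≤ 48 / c ^ 2 := by
    rw [le_div_iff₀ (by positivity)]
    exact (mul_le_mul_of_nonneg_left h2 (by positivity)).trans h1
  have : (n : ℝ) < M := by linarith
  exact_mod_cast this

lemma closure_PDist : closure PDist = PDist ∪ {0} := by
  refine Set.Subset.antisymm (fun d hd => ?_)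
    (Set.union_subset subset_closure (Set.singleton_subset_iff.2 zero_mem_closure_PDist))
  have hsub : PDist ⊆ {d : ℕ → ℝ | Antitone d} ∩ ⋂ k, {d : ℕ → ℝ | 0 ≤ d k} := by
    rw [PDist_eq_iUnion]
    intro d hd
    obtain ⟨n, hn⟩ := Set.mem_iUnion.1 hd
    exact ⟨(PDistOf.isSpectrum hn).antitone, Set.mem_iInter.2 (PDistOf.isSpectrum hn).nonneg⟩
  have hcl : IsClosed ({d : ℕ → ℝ | Antitone d} ∩ ⋂ k, {d : ℕ → ℝ | 0 ≤ d k}) :=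
    isClosed_antitone.inter
      (isClosed_iInter fun k => isClosed_le continuous_const (continuous_apply k))
  obtain ⟨hanti, hnn⟩ := closure_minimal hsub hcl hd
  replace hnn : ∀ k, 0 ≤ d k := Set.mem_iInter.1 hnn
  by_cases h0 : d 0 = 0
  · refine Or.inr (funext fun k => le_antisymm ((hanti k.zero_le).trans h0.le) (hnn k))
  · have hpos : 0 < d 0 := (hnn 0).lt_of_ne' h0
    obtain ⟨M, hM⟩ := exists_subset_biUnion_PDistOf (half_pos hpos)
    have hopen : IsOpen {y : ℕ → ℝ | d 0 / 2 < y 0} :=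
      isOpen_lt continuous_const (by fun_prop)
    -- Near `d` only finitely many compact pieces occur, and their union is closed.
    have hd' : d ∈ closure (PDist ∩ {y : ℕ → ℝ | d 0 / 2 < y 0}) := by
      rw [Set.inter_comm]
      exact hopen.inter_closure ⟨half_lt_self hpos, hd⟩
    have hK : IsClosed (⋃ n ∈ Finset.range M, PDistOf n) :=
      ((Finset.range M).isCompact_biUnion fun n _ => isCompact_PDistOf n).isClosed
    obtain ⟨n, -, hn⟩ := Set.mem_iUnion₂.1 (closure_minimal hM hK hd')
    exact Or.inl (PDist_eq_iUnion ▸ Set.mem_iUnion.2 ⟨n, hn⟩)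

lemma isCompact_closure_PDist : IsCompact (closure PDist) := by
  -- The bound 12 is generous: `2 * d 0 ^ 2 ≤ 48` already follows from `PDistOf.sq_le`.
  refine (isCompact_univ_pi fun _ : ℕ => isCompact_Icc (a := (0 : ℝ)) (b := 12)).of_isClosed_subset
    isClosed_closure (closure_minimal ?_ ?_)
  · rw [PDist_eq_iUnion]
    intro d hd k _
    obtain ⟨n, hn⟩ := Set.mem_iUnion.1 hd
    have hS := PDistOf.isSpectrum hn
    refine ⟨hS.nonneg k, (hS.antitone k.zero_le).trans ?_⟩
    have h1 := PDistOf.sq_le hn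
    have h2 : (0 : ℝ) ≤ n * d 0 ^ 2 := by positivity
    nlinarith
  · exact (isCompact_univ_pi fun _ => isCompact_Icc).isClosed

/-! ### Products of `sinc` functions determine the scales -/

lemma sinc_eq_zero_iff {x : ℝ} : Real.sinc x = 0 ↔ x ≠ 0 ∧ Real.sin x = 0 := by
  rcases eq_or_ne x 0 with rfl | hx
  · simp
  · simp [Real.sinc_of_ne_zero hx, hx]

lemma countable_sinc_mul_eq_zero (a : ℝ) : {ξ : ℝ | Real.sinc (a * ξ / 2) = 0}.Countable := by
  rcases eq_or_ne a 0 with rfl | ha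
  · simp
  refine (Set.countable_range fun n : ℤ => n * Real.pi / a * 2).mono fun ξ hξ => ?_
  obtain ⟨n, hn⟩ := Real.sin_eq_zero_iff.1 (sinc_eq_zero_iff.1 hξ).2
  refine ⟨n, ?_⟩
  dsimp only
  rw [hn]
  field_simp

/-- The product vanishes only on a countable set, so it can be cancelled on a dense set, and
continuity does the rest. -/
lemma eq_of_prod_sinc_mul_eq {s : Finset ℕ} {d : ℕ → ℝ} {f g : ℝ → ℝ} (hf : Continuous f)
    (hg : Continuous g)
    (h : ∀ ξ, (∏ k ∈ s, Real.sinc (d k * ξ / 2)) * f ξ =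
      (∏ k ∈ s, Real.sinc (d k * ξ / 2)) * g ξ) : f = g := by
  have hc : (⋃ k ∈ s, {ξ : ℝ | Real.sinc (d k * ξ / 2) = 0}).Countable :=
    s.countable_toSet.biUnion fun k _ => countable_sinc_mul_eq_zero (d k)
  refine hf.ext_on (hc.dense_compl ℝ) hg fun ξ hξ => mul_left_cancel₀ ?_ (h ξ)
  rw [Finset.prod_ne_zero_iff]
  intro k hk h0
  exact hξ (Set.mem_biUnion (Finset.mem_coe.2 hk) h0)

lemma le_of_sinc_eq_zero {a b : ℝ} (ha : 0 < a) (hb : 0 ≤ b)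
    (h : Real.sinc (b * (2 * Real.pi / a) / 2) = 0) : a ≤ b := by
  obtain ⟨hne, h0⟩ := sinc_eq_zero_iff.1 h
  by_contra! hlt
  have hb' : 0 < b := hb.lt_of_ne' fun h => hne (by simp [h])
  have e : b * (2 * Real.pi / a) / 2 = b / a * Real.pi := by
    field_simp
  rw [e] at h0
  refine (Real.sin_pos_of_pos_of_lt_pi (by positivity) ?_).ne' h0
  exact mul_lt_of_lt_one_left Real.pi_pos ((div_lt_one ha).2 hlt)

lemma eq_zero_of_prod_sinc {d : ℕ → ℝ} {s : Finset ℕ} {k : ℕ} (hk : k ∈ s) (hd : 0 < d k) :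
    ∏ j ∈ s, Real.sinc (d j * (2 * Real.pi / d k) / 2) = 0 := by
  refine Finset.prod_eq_zero hk (sinc_eq_zero_iff.2 ?_)
  have e : d k * (2 * Real.pi / d k) / 2 = Real.pi := by
    field_simp
  rw [e]
  exact ⟨Real.pi_ne_zero, Real.sin_pi⟩

lemma continuous_prod_sinc (s : Finset ℕ) (d : ℕ → ℝ) :
    Continuous fun ξ : ℝ => ∏ k ∈ s, Real.sinc (d k * ξ / 2) :=
  continuous_finsetProd _ fun k _ => Real.continuous_sinc.comp (by fun_prop)

/-- At `ξ = 2π / d k` the left product vanishes, whereas factors with scales below `d k` have no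
zero there. -/
lemma le_of_prod_sinc_eq {d d' : ℕ → ℝ} {N k : ℕ} (h : Antitone d') (h0 : ∀ k, 0 ≤ d' k)
    (hk : k < N)
    (heq : ∀ ξ : ℝ, ∏ j ∈ Finset.Ico k N, Real.sinc (d j * ξ / 2) =
      ∏ j ∈ Finset.Ico k N, Real.sinc (d' j * ξ / 2)) : d k ≤ d' k := by
  by_contra! hlt
  have hpos : 0 < d k := (h0 k).trans_lt hlt
  have h1 := eq_zero_of_prod_sinc (s := Finset.Ico k N) (Finset.left_mem_Ico.2 hk) hpos
  rw [heq, Finset.prod_eq_zero_iff] at h1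
  obtain ⟨j, hj, hj0⟩ := h1
  have := le_of_sinc_eq_zero hpos (h0 j) hj0
  exact absurd (this.trans (h (Finset.mem_Ico.1 hj).1)) hlt.not_ge

lemma eq_of_prod_sinc_eq {d d' : ℕ → ℝ} {N : ℕ} (hd : Antitone d) (hd' : Antitone d')
    (h0 : ∀ k, 0 ≤ d k) (h0' : ∀ k, 0 ≤ d' k)
    (heq : ∀ ξ : ℝ, ∏ j ∈ Finset.range N, Real.sinc (d j * ξ / 2) =
      ∏ j ∈ Finset.range N, Real.sinc (d' j * ξ / 2)) (k : ℕ) (hk : k < N) : d k = d' k := by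
  induction k using Nat.strong_induction_on with
  | _ k ih =>
    have htail : (fun ξ : ℝ => ∏ j ∈ Finset.Ico k N, Real.sinc (d j * ξ / 2)) =
        fun ξ : ℝ => ∏ j ∈ Finset.Ico k N, Real.sinc (d' j * ξ / 2) := by
      refine eq_of_prod_sinc_mul_eq (s := Finset.range k) (d := d)
        (continuous_prod_sinc _ _) (continuous_prod_sinc _ _) fun ξ => ?_
      have hc : ∏ j ∈ Finset.range k, Real.sinc (d j * ξ / 2) =
          ∏ j ∈ Finset.range k, Real.sinc (d' j * ξ / 2) := by
        refine Finset.prod_congr rfl fun j hj => ?_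
        rw [ih j (Finset.mem_range.1 hj) ((Finset.mem_range.1 hj).trans hk)]
      rw [Finset.prod_range_mul_prod_Ico _ hk.le, hc, Finset.prod_range_mul_prod_Ico _ hk.le,
        heq]
    exact le_antisymm (le_of_prod_sinc_eq hd' h0' hk fun ξ => congrFun htail ξ)
      (le_of_prod_sinc_eq hd h0 hk fun ξ => (congrFun htail ξ).symm)

/-! ### Comparison of `sinc` with a Gaussian -/

/-- For `|x| < 1` both functions are within `|x|³` of `1 - x² / 6`; for `|x| ≥ 1` both are bounded
by 1. The exponent 3 leaves one power of the scale to spare beyond the square. -/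
lemma abs_sinc_sub_exp_le (x : ℝ) :
    |Real.sinc x - Real.exp (-(x ^ 2 / 6))| ≤ 2 * |x| ^ 3 := by
  rcases eq_or_ne x 0 with rfl | hx
  · simp
  rcases le_or_gt 1 |x| with h | h
  · have h1 := Real.abs_sinc_le_one x
    have h2 : |Real.exp (-(x ^ 2 / 6))| ≤ 1 := by
      rw [abs_of_pos (Real.exp_pos _), Real.exp_le_one_iff, neg_nonpos]
      positivity
    have h3 : (1 : ℝ) ≤ |x| ^ 3 := one_le_pow₀ h
    linarith [abs_sub (Real.sinc x) (Real.exp (-(x ^ 2 / 6)))]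
  · have hx0 : 0 < |x| := abs_pos.2 hx
    have h1 : |Real.sinc x - (1 - x ^ 2 / 6)| ≤ |x| ^ 3 := by
      have e : Real.sinc x - (1 - x ^ 2 / 6) = (Real.sin x - (x - x ^ 3 / 6)) / x := by
        rw [Real.sinc_of_ne_zero hx]
        field_simp
      rw [e, abs_div, div_le_iff₀ hx0]
      refine (Real.sin_bound h.le).trans ?_
      have : |x| ^ 3 * |x| = |x| ^ 4 := by ring
      rw [this]
      have h5 : |x| ^ 5 ≤ |x| ^ 4 := pow_le_pow_of_le_one hx0.le h.le (by norm_num)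
      have h4 : 0 ≤ |x| ^ 4 := by positivity
      linarith
    have hsq : x ^ 2 ≤ 1 := by
      rw [← sq_abs]
      exact pow_le_one₀ hx0.le h.le
    have h2 : |Real.exp (-(x ^ 2 / 6)) - 1 - -(x ^ 2 / 6)| ≤ |x| ^ 3 := by
      refine (Real.abs_exp_sub_one_sub_id_le ?_).trans ?_
      · rw [abs_neg, abs_of_nonneg (by positivity)]
        linarith
      · have e : (-(x ^ 2 / 6)) ^ 2 = |x| ^ 4 / 36 := by
          rw [← abs_pow, abs_of_nonneg (by positivity)]
          ring
        rw [e]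
        have h5 : |x| ^ 4 ≤ |x| ^ 3 := pow_le_pow_of_le_one hx0.le h.le (by norm_num)
        have h4 : 0 ≤ |x| ^ 4 := by positivity
        linarith
    have e : Real.sinc x - Real.exp (-(x ^ 2 / 6)) = (Real.sinc x - (1 - x ^ 2 / 6)) -
        (Real.exp (-(x ^ 2 / 6)) - 1 - -(x ^ 2 / 6)) := by ring
    rw [e]
    linarith [abs_sub (Real.sinc x - (1 - x ^ 2 / 6))
      (Real.exp (-(x ^ 2 / 6)) - 1 - -(x ^ 2 / 6))]

lemma abs_prod_sub_prod_le {ι : Type*} (s : Finset ι) {a b : ι → ℝ} (ha : ∀ i, |a i| ≤ 1)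
    (hb : ∀ i, |b i| ≤ 1) : |∏ i ∈ s, a i - ∏ i ∈ s, b i| ≤ ∑ i ∈ s, |a i - b i| := by
  classical
  induction s using Finset.induction_on with
  | empty => simp
  | insert i s hi ih =>
    rw [Finset.prod_insert hi, Finset.prod_insert hi, Finset.sum_insert hi]
    have e : a i * ∏ j ∈ s, a j - b i * ∏ j ∈ s, b j =
        (a i - b i) * ∏ j ∈ s, a j + b i * (∏ j ∈ s, a j - ∏ j ∈ s, b j) := by ring
    have hp : |∏ j ∈ s, a j| ≤ 1 := by
      rw [Finset.abs_prod]
      exact Finset.prod_le_one (fun j _ => abs_nonneg _) fun j _ => ha j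
    rw [e]
    refine (abs_add_le _ _).trans (add_le_add ?_ ?_)
    · rw [abs_mul]
      exact mul_le_of_le_one_right (abs_nonneg _) hp
    · rw [abs_mul]
      exact (mul_le_of_le_one_left (abs_nonneg _) (hb i)).trans ih

/-- The Gaussian factors over the scales because `∑ d k ^ 2 = 12`. In each cubic error one factor `d
k` is bounded by `d 0`, and the remaining squares sum to 12, giving `12 / 4 = 3`. -/
lemma IsSpectrum.abs_prod_sinc_sub_exp_le {N : ℕ} {d : ℕ → ℝ} (h : IsSpectrum N d) (ξ : ℝ) :
    |∏ k ∈ Finset.range N, Real.sinc (d k * ξ / 2) - Real.exp (-(ξ ^ 2 / 2))| ≤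
      3 * |ξ| ^ 3 * d 0 := by
  have e : Real.exp (-(ξ ^ 2 / 2)) =
      ∏ k ∈ Finset.range N, Real.exp (-((d k * ξ / 2) ^ 2 / 6)) := by
    rw [← Real.exp_sum, Finset.sum_neg_distrib]
    have : ∀ k, (d k * ξ / 2) ^ 2 / 6 = d k ^ 2 * (ξ ^ 2 / 24) := fun k => by ring
    simp_rw [this]
    rw [← Finset.sum_mul, h.sum_sq]
    congr 2
    ring
  rw [e]
  refine (abs_prod_sub_prod_le _ (fun k => Real.abs_sinc_le_one _) fun k => ?_).trans ?_
  · rw [abs_of_pos (Real.exp_pos _), Real.exp_le_one_iff, neg_nonpos]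
    positivity
  have hb : ∀ k, |Real.sinc (d k * ξ / 2) - Real.exp (-((d k * ξ / 2) ^ 2 / 6))| ≤
      d k ^ 2 * (|ξ| ^ 3 * d 0 / 4) := fun k => by
    refine (abs_sinc_sub_exp_le _).trans ?_
    have hk := h.nonneg k
    have e : 2 * |d k * ξ / 2| ^ 3 = d k ^ 2 * (|ξ| ^ 3 * d k / 4) := by
      rw [abs_div, abs_mul, abs_of_nonneg hk, abs_of_pos (two_pos : (0 : ℝ) < 2)]
      ring
    rw [e]
    have := h.antitone k.zero_le
    gcongr
  refine (Finset.sum_le_sum fun k _ => hb k).trans ?_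
  rw [← Finset.sum_mul, h.sum_sq]
  apply le_of_eq
  ring

/-! ### The law attached to a point of the closure -/

open Classical in
/-- The law of a parameter sequence, with the zero sequence sent to the standard normal law. -/
noncomputable def limitLaw (d : ℕ → ℝ) : ProbabilityMeasure ℝ :=
  if d = 0 then stdNormal else uniformSum d

lemma limitLaw_zero : limitLaw 0 = stdNormal := if_pos rfl

lemma limitLaw_of_mem {d : ℕ → ℝ} (hd : d ∈ PDist) : limitLaw d = uniformSum d :=
  if_neg fun h : d = 0 => zero_notMem_PDist (h ▸ hd)

lemma charFun_stdNormal (ξ : ℝ) :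
    charFun (stdNormal : Measure ℝ) ξ = ((Real.exp (-(ξ ^ 2 / 2)) : ℝ) : ℂ) := by
  change charFun (gaussianReal 0 1) ξ = _
  rw [charFun_gaussianReal]
  push_cast
  congr 1
  simp

lemma IsSpectrum.charFun_uniformSum {N : ℕ} {d : ℕ → ℝ} (h : IsSpectrum N d) (ξ : ℝ) :
    charFun (uniformSum d : Measure ℝ) ξ =
      ((∏ k ∈ Finset.range N, Real.sinc (d k * ξ / 2) : ℝ) : ℂ) :=
  DistModuli.charFun_uniformSum h.nonneg h.eq_zero ξ

lemma IsSpectrum.mono {N N' : ℕ} {d : ℕ → ℝ} (h : IsSpectrum N d) (hN : N ≤ N') :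
    IsSpectrum N' d where
  antitone := h.antitone
  nonneg := h.nonneg
  eq_zero k hk := h.eq_zero k (hN.trans hk)
  sum_sq := by
    rw [← h.sum_sq]
    refine (Finset.sum_subset (Finset.range_mono hN) fun k _ hk => ?_).symm
    rw [h.eq_zero k (by simpa using hk)]
    simp

lemma exists_isSpectrum {d : ℕ → ℝ} (hd : d ∈ PDist) : ∃ N, IsSpectrum N d := by
  rw [PDist_eq_iUnion, Set.mem_iUnion] at hd
  obtain ⟨n, hn⟩ := hd
  exact ⟨_, PDistOf.isSpectrum hn⟩

/-- A common support bound `N` turns the characteristic functions into one finite product, visibly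
continuous in `d`. -/
lemma exists_isSpectrum_of_lt {c : ℝ} (hc : 0 < c) :
    ∃ N, ∀ d ∈ PDist, c < d 0 → IsSpectrum N d := by
  obtain ⟨M, hM⟩ := exists_subset_biUnion_PDistOf hc
  refine ⟨∑ n ∈ Finset.range M, Fintype.card (Pairs (n + 2)), fun d hd hdc => ?_⟩
  obtain ⟨n, hn, hdn⟩ := Set.mem_iUnion₂.1 (hM ⟨hd, hdc⟩)
  exact (PDistOf.isSpectrum hdn).mono
    (Finset.single_le_sum (f := fun n => Fintype.card (Pairs (n + 2))) (by simp) hn)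

/-- The characteristic function vanishes at `2π / d 0`; that of the normal law never does. -/
lemma uniformSum_ne_stdNormal {d : ℕ → ℝ} (hd : d ∈ PDist) : uniformSum d ≠ stdNormal := by
  obtain ⟨N, hN⟩ := exists_isSpectrum hd
  intro h
  have h1 := hN.charFun_uniformSum (2 * Real.pi / d 0)
  have h0 : 0 < N := by
    by_contra! h
    exact hN.zero_pos.ne' (hN.eq_zero 0 h)
  rw [h, charFun_stdNormal, eq_zero_of_prod_sinc (Finset.mem_range.2 h0) hN.zero_pos] at h1
  exact (Real.exp_pos _).ne' (by exact_mod_cast h1)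

lemma uniformSum_injOn : Set.InjOn uniformSum PDist := by
  intro d hd d' hd' h
  obtain ⟨N₁, h₁⟩ := exists_isSpectrum hd
  obtain ⟨N₂, h₂⟩ := exists_isSpectrum hd'
  replace h₁ := h₁.mono (le_max_left N₁ N₂)
  replace h₂ := h₂.mono (le_max_right N₁ N₂)
  ext k
  by_cases hk : k < max N₁ N₂
  · refine eq_of_prod_sinc_eq h₁.antitone h₂.antitone h₁.nonneg h₂.nonneg (fun ξ => ?_) k hk
    have := h₁.charFun_uniformSum ξ
    rw [h, h₂.charFun_uniformSum ξ] at this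
    exact_mod_cast this.symm
  · rw [h₁.eq_zero k (not_lt.1 hk), h₂.eq_zero k (not_lt.1 hk)]

lemma limitLaw_injOn : Set.InjOn limitLaw (closure PDist) := by
  rw [closure_PDist]
  rintro d (hd | rfl) d' (hd' | rfl) h
  · rw [limitLaw_of_mem hd, limitLaw_of_mem hd'] at h
    exact uniformSum_injOn hd hd' h
  · rw [limitLaw_of_mem hd, limitLaw_zero] at h
    exact absurd h (uniformSum_ne_stdNormal hd)
  · rw [limitLaw_of_mem hd', limitLaw_zero] at h
    exact absurd h.symm (uniformSum_ne_stdNormal hd')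
  · rfl

lemma continuousWithinAt_charFun_limitLaw_zero (ξ : ℝ) :
    ContinuousWithinAt (fun d => charFun (limitLaw d : Measure ℝ) ξ) (closure PDist) 0 := by
  rw [ContinuousWithinAt, limitLaw_zero, tendsto_iff_norm_sub_tendsto_zero]
  have hlim : Tendsto (fun d : ℕ → ℝ => 3 * |ξ| ^ 3 * d 0) (𝓝[closure PDist] 0) (𝓝 0) := by
    have : Continuous fun d : ℕ → ℝ => 3 * |ξ| ^ 3 * d 0 := by fun_prop
    simpa using (this.tendsto 0).mono_left nhdsWithin_le_nhds
  refine squeeze_zero' (Eventually.of_forall fun d => norm_nonneg _) ?_ hlim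
  filter_upwards [self_mem_nhdsWithin] with d hd
  rw [closure_PDist] at hd
  rcases hd with hd | rfl
  · obtain ⟨N, hN⟩ := exists_isSpectrum hd
    rw [limitLaw_of_mem hd, hN.charFun_uniformSum, charFun_stdNormal, ← Complex.ofReal_sub,
      Complex.norm_real]
    exact hN.abs_prod_sinc_sub_exp_le ξ
  · simp [limitLaw_zero]

lemma continuousWithinAt_charFun_limitLaw {d : ℕ → ℝ} (hd : d ∈ PDist) (ξ : ℝ) :
    ContinuousWithinAt (fun d => charFun (limitLaw d : Measure ℝ) ξ) (closure PDist) d := by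
  obtain ⟨N₀, hN₀⟩ := exists_isSpectrum hd
  have hpos := hN₀.zero_pos
  obtain ⟨N, hN⟩ := exists_isSpectrum_of_lt (half_pos hpos)
  have key : ∀ y ∈ PDist, d 0 / 2 < y 0 → charFun (limitLaw y : Measure ℝ) ξ =
      ((∏ k ∈ Finset.range N, Real.sinc (y k * ξ / 2) : ℝ) : ℂ) := fun y hy hy0 => by
    rw [limitLaw_of_mem hy, (hN y hy hy0).charFun_uniformSum]
  have hcont : Continuous fun y : ℕ → ℝ =>
      ((∏ k ∈ Finset.range N, Real.sinc (y k * ξ / 2) : ℝ) : ℂ) :=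
    Complex.continuous_ofReal.comp
      (continuous_finsetProd _ fun k _ => Real.continuous_sinc.comp (by fun_prop))
  refine hcont.continuousWithinAt.congr_of_eventuallyEq ?_ (key d hd (half_lt_self hpos))
  have hopen : {y : ℕ → ℝ | d 0 / 2 < y 0} ∈ 𝓝 d :=
    (isOpen_lt continuous_const (by fun_prop)).mem_nhds (half_lt_self hpos)
  filter_upwards [self_mem_nhdsWithin, mem_nhdsWithin_of_mem_nhds hopen] with y hy hy0
  rw [closure_PDist] at hy
  rcases hy with hy | rfl
  · exact key y hy hy0
  · exact absurd (hy0 : d 0 / 2 < 0) (half_pos hpos).not_gt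

lemma continuousOn_limitLaw : ContinuousOn limitLaw (closure PDist) := by
  rw [continuousOn_iff_continuous_domRestrict]
  -- Sequences suffice in a subspace of `ℕ → ℝ`, and along them Lévy's theorem reduces weak
  -- convergence to characteristic functions.
  refine continuous_iff_seqContinuous.2 fun u d hu => ?_
  refine ProbabilityMeasure.tendsto_of_tendsto_charFun fun ξ => ?_
  have hc : ContinuousWithinAt (fun d => charFun (limitLaw d : Measure ℝ) ξ)
      (closure PDist) d := by
    have hd : (d : ℕ → ℝ) ∈ PDist ∪ {0} := closure_PDist ▸ d.2
    rcases hd with hd | hd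
    · exact continuousWithinAt_charFun_limitLaw hd ξ
    · rw [Set.mem_singleton_iff.1 hd]
      exact continuousWithinAt_charFun_limitLaw_zero ξ
  refine Tendsto.comp (f := fun n => (u n : ℕ → ℝ)) hc (tendsto_nhdsWithin_iff.2 ⟨?_, ?_⟩)
  · exact (continuous_subtype_val.tendsto d).comp hu
  · exact Eventually.of_forall fun n => (u n).2

/-! ### The moduli space as an image -/

lemma image_limitLaw_PDist : limitLaw '' PDist = MDist := by
  have h : ∀ (n : ℕ) (t : Fin (n + 2) → ℝ), IsNormalized t →
      limitLaw (hat (distSeq t)) = standardize (uniformSum (distSeq t)) := fun n t ht => by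
    rw [limitLaw_of_mem ⟨n, t, ht, rfl⟩,
      standardize_uniformSum ht.distSeq_nonneg (distSeq_eq_zero t)]
  ext P
  constructor
  · rintro ⟨_, ⟨n, t, ht, rfl⟩, rfl⟩
    exact ⟨n, t, ht, h n t ht⟩
  · rintro ⟨n, t, ht, rfl⟩
    exact ⟨_, ⟨n, t, ht, rfl⟩, h n t ht⟩

lemma image_limitLaw_closure : limitLaw '' closure PDist = MDist ∪ {stdNormal} := by
  rw [closure_PDist, Set.image_union, image_limitLaw_PDist, Set.image_singleton, limitLaw_zero]

/-- The image is compact, hence closed, and contains `MDist`; continuity gives the other inclusion.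
-/
lemma closure_MDist_eq_image : closure MDist = limitLaw '' closure PDist := by
  refine Set.Subset.antisymm (closure_minimal ?_ ?_) ?_
  · rw [← image_limitLaw_PDist]
    exact Set.image_mono subset_closure
  · exact (isCompact_closure_PDist.image_of_continuousOn continuousOn_limitLaw).isClosed
  · rw [← image_limitLaw_PDist]
    exact continuousOn_limitLaw.image_closure

lemma stdNormal_notMem_MDist : stdNormal ∉ MDist := by
  rw [← image_limitLaw_PDist]
  rintro ⟨d, hd, h⟩
  rw [limitLaw_of_mem hd] at h
  exact uniformSum_ne_stdNormal hd h

/-- The homeomorphism between the closures induced by `limitLaw`. -/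
noncomputable def limitLawHomeomorph : closure PDist ≃ₜ closure MDist :=
  haveI : CompactSpace (closure PDist) := isCompact_iff_compactSpace.1 isCompact_closure_PDist
  Continuous.homeoOfEquivCompactToT2
    (f := (Set.BijOn.equiv limitLaw ⟨fun _ hd => closure_MDist_eq_image ▸ Set.mem_image_of_mem _ hd,
      limitLaw_injOn, closure_MDist_eq_image.subset⟩))
    (continuousOn_limitLaw.domRestrict.subtype_mk _)

lemma coe_limitLawHomeomorph (d : closure PDist) :
    (limitLawHomeomorph d : ProbabilityMeasure ℝ) = limitLaw d := rfl

end DistModuli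

theorem mainTheorem10 :
    (closure DistModuli.PDist = DistModuli.PDist ∪ {0} ∧ (0 : ℕ → ℝ) ∉ DistModuli.PDist) ∧
    (closure DistModuli.MDist = DistModuli.MDist ∪ {DistModuli.stdNormal} ∧
      DistModuli.stdNormal ∉ DistModuli.MDist) ∧
    (∃ Φ : closure DistModuli.PDist ≃ₜ closure DistModuli.MDist,
      (∀ d : closure DistModuli.PDist, (d : ℕ → ℝ) ∈ DistModuli.PDist →
        (Φ d : ProbabilityMeasure ℝ) = DistModuli.uniformSum d) ∧
      (∀ d : closure DistModuli.PDist, (d : ℕ → ℝ) = 0 →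
        (Φ d : ProbabilityMeasure ℝ) = DistModuli.stdNormal)) ∧
    (IsCompact (closure DistModuli.PDist) ∧ IsSeqCompact (closure DistModuli.PDist)) ∧
    (IsCompact (closure DistModuli.MDist) ∧ IsSeqCompact (closure DistModuli.MDist)) := by
  have hP : IsSeqCompact (closure DistModuli.PDist) :=
    DistModuli.isCompact_closure_PDist.isSeqCompact
  refine ⟨⟨DistModuli.closure_PDist, DistModuli.zero_notMem_PDist⟩,
    ⟨DistModuli.closure_MDist_eq_image.trans DistModuli.image_limitLaw_closure,
      DistModuli.stdNormal_notMem_MDist⟩,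
    ⟨DistModuli.limitLawHomeomorph, fun d hd => ?_, fun d hd => ?_⟩,
    ⟨DistModuli.isCompact_closure_PDist, hP⟩, ?_, ?_⟩
  · rw [DistModuli.coe_limitLawHomeomorph, DistModuli.limitLaw_of_mem hd]
  · rw [DistModuli.coe_limitLawHomeomorph, hd, DistModuli.limitLaw_zero]
  · rw [DistModuli.closure_MDist_eq_image]
    exact DistModuli.isCompact_closure_PDist.image_of_continuousOn
      DistModuli.continuousOn_limitLaw
  · intro u hu
    -- The subsequence is extracted on the parameter side and carried back by the homeomorphism.
    let v := fun n => DistModuli.limitLawHomeomorph.symm ⟨u n, hu n⟩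
    obtain ⟨d, hd, φ, hφ, hlim⟩ := hP fun n => (v n).2
    refine ⟨DistModuli.limitLawHomeomorph ⟨d, hd⟩, Subtype.coe_prop _, φ, hφ, ?_⟩
    have hv : Tendsto (v ∘ φ) atTop (𝓝 ⟨d, hd⟩) := tendsto_subtype_rng.2 hlim
    have h := (continuous_subtype_val.comp DistModuli.limitLawHomeomorph.continuous).tendsto
      ⟨d, hd⟩ |>.comp hv
    simpa [Function.comp_def, v] using h
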